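/- Let $G$ be a non-discrete compact (Hausdorff) topological group, and let $\nu$ be its Haar measure, normalized by $\nu(G)=1$. Then for every neighbourhood $U$ of the identity of $G$ there exists a finite partition $\mathcal P$ of $G$ into Borel measurable sets such that 1. ($U$-fine) for every $P\in\mathcal P$ there is $g\in G$ with $P\subseteq gU$; 2. ($\mathcal P$ is equisize) all sets in $\mathcal P$ have the same Haar measure. -/

import Mathlib

open MeasureTheory Topology
open scoped Pointwise

/-- A family `P` of subsets of a group is `U`-fine if each member lies in a left translate of `U`. -/
def IsFine {G : Type*} [Group G] (U : Set G) (P : Set (Set G)) : Prop :=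
  ∀ A ∈ P, ∃ g : G, A ⊆ g • U

/-- A family `P` of subsets is equisize if all its members have the same measure. -/
def IsEquisize {G : Type*} [MeasurableSpace G] (ν : Measure G) (P : Set (Set G)) : Prop :=
  ∀ A ∈ P, ∀ B ∈ P, ν A = ν B

/-!
Choose a closed symmetric neighbourhood `V` of the identity with `V ^ 8 ⊆ U`. The subgroup `H`
generated by `V` is open, so it has finitely many cosets, and it suffices to cut `H` into finitely
many sets of one measure `c`, each inside a translate of `V ^ 8`, and to translate these to the
other cosets.

Take a maximal finite set `F ⊆ H` for which the translates `f V` are disjoint. Then the sets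
`f V ^ 3` cover `H`, so `H` is a disjoint union of cells `C f` with `f V ⊆ C f ⊆ f V ^ 3`. Joining
`f` and `g` when `g ∈ f V ^ 7` makes `F` a connected graph, since `V` generates `H`
(`translateGraph_connected`).

Let `c = ν H / n` with `n` so large that `c ≤ ν V`. A non-cut vertex `v` of the graph can be
removed: all of `C v` but a part of measure less than `c` is cut into sets of measure `c`, and that
part, taken inside `v V`, is added to the cell of a neighbour. Only points of the core `f V` are ever
handed on by `f`, at most once and to a neighbour, so the cell of `f` never leaves `f V ^ 8`. The last cell has a
measure which is a multiple of `c`, because `ν H` is (`hasEquipartition_iUnion_of_connected`).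

Cutting off sets of prescribed measure is possible because a non-discrete compact group has finite
covers by sets of arbitrarily small Haar measure (`exists_measurable_subset_haar_eq`).
-/

open Set

universe u v

/-! ### Measures with small finite covers attain all intermediate values -/

section Atomless

variable {X : Type u} [MeasurableSpace X] {μ : Measure X}

/-- Enlarge `B` inside `A` by a maximal subfamily of the cover for which the measure stays at most
`t`; one further member would exceed `t`. -/
theorem exists_measurable_between_of_finite_cover {ε t : ENNReal} {A B : Set X}
    {𝒞 : Set (Set X)} (h𝒞 : 𝒞.Finite) (h𝒞m : ∀ C ∈ 𝒞, MeasurableSet C)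
    (h𝒞ε : ∀ C ∈ 𝒞, μ C ≤ ε) (hcov : ⋃₀ 𝒞 = univ) (hA : MeasurableSet A)
    (hB : MeasurableSet B) (hBA : B ⊆ A) (hBt : μ B ≤ t) (htA : t ≤ μ A) :
    ∃ B', B ⊆ B' ∧ B' ⊆ A ∧ MeasurableSet B' ∧ μ B' ≤ t ∧ t ≤ μ B' + ε := by
  classical
  have hfin : {S : Set (Set X) | S ⊆ 𝒞 ∧ μ (B ∪ A ∩ ⋃₀ S) ≤ t}.Finite :=
    h𝒞.finite_subsets.subset fun S hS => hS.1
  obtain ⟨S, hS⟩ := hfin.exists_maximal ⟨∅, by simp [hBt]⟩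
  have hSm : MeasurableSet (B ∪ A ∩ ⋃₀ S) :=
    hB.union (hA.inter (MeasurableSet.sUnion (h𝒞.subset hS.prop.1).countable
      fun C hC => h𝒞m C (hS.prop.1 hC)))
  refine ⟨B ∪ A ∩ ⋃₀ S, subset_union_left, union_subset hBA inter_subset_left, hSm,
    hS.prop.2, ?_⟩
  by_cases hall : 𝒞 ⊆ S
  · refine le_trans (htA.trans (measure_mono fun x hx => Or.inr ⟨hx, ?_⟩)) le_self_add
    exact sUnion_subset_sUnion hall (hcov ▸ mem_univ x)
  · obtain ⟨C, hC, hCS⟩ := not_subset.1 hall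
    by_contra! hlt
    have hle : μ (B ∪ A ∩ ⋃₀ insert C S) ≤ t := by
      refine le_trans (measure_mono ?_) <| (measure_union_le (B ∪ A ∩ ⋃₀ S) C).trans
        ((add_le_add le_rfl (h𝒞ε C hC)).trans hlt.le)
      intro x
      simp only [sUnion_insert, mem_union, mem_inter_iff]
      tauto
    exact hCS (hS.le_of_ge ⟨insert_subset hC hS.prop.1, hle⟩ (subset_insert C S)
      (mem_insert C S))

/-- If the space has finite measurable covers by sets of arbitrarily small measure, then below any
measurable set every smaller value is attained: approximate the value from below along an
increasing sequence of subsets. -/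
theorem exists_measurable_subset_measure_eq
    (hμ : ∀ ε : ENNReal, ε ≠ 0 → ∃ 𝒞 : Set (Set X), 𝒞.Finite ∧ (∀ C ∈ 𝒞, MeasurableSet C) ∧
      (∀ C ∈ 𝒞, μ C ≤ ε) ∧ ⋃₀ 𝒞 = univ)
    {A : Set X} (hA : MeasurableSet A) {t : ENNReal} (ht : t ≤ μ A) :
    ∃ B ⊆ A, MeasurableSet B ∧ μ B = t := by
  have step : ∀ (n : ℕ) (B : {B : Set X // B ⊆ A ∧ MeasurableSet B ∧ μ B ≤ t}),
      ∃ B' : {B : Set X // B ⊆ A ∧ MeasurableSet B ∧ μ B ≤ t},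
        B.1 ⊆ B'.1 ∧ t ≤ μ B'.1 + ((n : ENNReal) + 1)⁻¹ := by
    rintro n ⟨B, hBA, hB, hBt⟩
    obtain ⟨𝒞, h1, h2, h3, h4⟩ := hμ ((n : ENNReal) + 1)⁻¹
      (ENNReal.inv_ne_zero.2 (by finiteness))
    obtain ⟨B', h5, h6, h7, h8, h9⟩ :=
      exists_measurable_between_of_finite_cover h1 h2 h3 h4 hA hB hBA hBt ht
    exact ⟨⟨B', h6, h7, h8⟩, h5, h9⟩
  choose next hsub happ using step
  let S : ℕ → {B : Set X // B ⊆ A ∧ MeasurableSet B ∧ μ B ≤ t} := fun n =>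
    Nat.rec ⟨∅, empty_subset _, MeasurableSet.empty, by simp⟩ next n
  have hmono : Monotone fun n => (S n).1 := monotone_nat_of_le_succ fun n => hsub n (S n)
  refine ⟨⋃ n, (S n).1, iUnion_subset fun n => (S n).2.1,
    MeasurableSet.iUnion fun n => (S n).2.2.1, le_antisymm ?_ ?_⟩
  · rw [hmono.measure_iUnion]
    exact iSup_le fun n => (S n).2.2.2
  · refine ENNReal.le_of_forall_pos_le_add fun ε hε _ => ?_
    obtain ⟨n, hn⟩ := ENNReal.exists_inv_nat_lt (a := (ε : ENNReal)) (by simpa using hε.ne')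
    refine (happ n (S n)).trans (add_le_add (measure_mono ?_) ?_)
    · exact subset_iUnion (fun n => (S n).1) (n + 1)
    · exact (ENNReal.inv_le_inv.2 le_self_add).trans hn.le

end Atomless

/-! ### Equipartitions of a connected system of cells -/

section Equipartition

variable {X : Type u} [MeasurableSpace X] {μ : Measure X} {c : ENNReal}

/-- `A` is a finite disjoint union of measurable sets of measure `c`, each satisfying `p`. -/
def HasEquipartition (μ : Measure X) (c : ENNReal) (p : Set X → Prop) (A : Set X) : Prop :=
  ∃ P : Set (Set X), P.Finite ∧ P.PairwiseDisjoint id ∧ ⋃₀ P = A ∧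
    ∀ B ∈ P, MeasurableSet B ∧ μ B = c ∧ p B

theorem HasEquipartition.mono {p q : Set X → Prop} {A : Set X} (h : HasEquipartition μ c p A)
    (hpq : ∀ B, p B → q B) : HasEquipartition μ c q A := by
  obtain ⟨P, h1, h2, h3, h4⟩ := h
  exact ⟨P, h1, h2, h3, fun B hB => ⟨(h4 B hB).1, (h4 B hB).2.1, hpq B (h4 B hB).2.2⟩⟩

theorem HasEquipartition.union {p : Set X → Prop} {A B : Set X} (hA : HasEquipartition μ c p A)
    (hB : HasEquipartition μ c p B) (hAB : Disjoint A B) : HasEquipartition μ c p (A ∪ B) := by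
  obtain ⟨P, h1, h2, h3, h4⟩ := hA
  obtain ⟨Q, k1, k2, k3, k4⟩ := hB
  refine ⟨P ∪ Q, h1.union k1, ?_, by rw [sUnion_union, h3, k3], ?_⟩
  · refine (pairwiseDisjoint_union).2 ⟨h2, k2, fun S hS T hT _ => ?_⟩
    exact hAB.mono (h3 ▸ subset_sUnion_of_mem hS) (k3 ▸ subset_sUnion_of_mem hT)
  · rintro S (hS | hS)
    exacts [h4 S hS, k4 S hS]

/-- A set whose measure is a positive multiple of `c` splits into pieces of measure `c`. The
multiple has to be positive since a nonempty null set has no such splitting. -/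
theorem hasEquipartition_of_measure_eq [IsFiniteMeasure μ]
    (hμ : ∀ (A : Set X) (t : ENNReal), MeasurableSet A → t ≤ μ A →
      ∃ B ⊆ A, MeasurableSet B ∧ μ B = t)
    (k : ℕ) {A : Set X} (hA : MeasurableSet A) (hk : μ A = (k + 1 : ℕ) * c) :
    HasEquipartition μ c (· ⊆ A) A := by
  induction k generalizing A with
  | zero => exact ⟨{A}, by simp, by simp, by simp, by simp [hA, hk]⟩
  | succ k ih =>
    have hk' : μ A = (k + 1 : ℕ) * c + c := by rw [hk]; push_cast; ring
    obtain ⟨B, hBA, hB, hBc⟩ := hμ A c hA (hk' ▸ le_add_self)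
    have hfin : μ B ≠ ⊤ := measure_ne_top μ B
    have hdiff : μ (A \ B) = (k + 1 : ℕ) * c := by
      rw [measure_sdiff hBA hB.nullMeasurableSet hfin, hk', hBc,
        ENNReal.add_sub_cancel_right (hBc ▸ hfin)]
    have h1 := (ih (hA.diff hB) hdiff).mono (q := (· ⊆ A)) fun S hS => hS.trans sdiff_subset
    have h2 : HasEquipartition μ c (· ⊆ A) B :=
      ⟨{B}, by simp, by simp, by simp, by simp [hB, hBc, hBA]⟩
    simpa [sdiff_union_of_subset hBA] using h1.union h2 disjoint_sdiff_left

theorem exists_nat_mul_add_lt {a c : ENNReal} (hc : c ≠ 0) (hca : c ≤ a) (ha : a ≠ ⊤) :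
    ∃ (m : ℕ) (r : ENNReal), r < c ∧ a = (m + 1 : ℕ) * c + r := by
  have hc' : c ≠ ⊤ := ne_top_of_le_ne_top ha hca
  lift a to NNReal using ha
  lift c to NNReal using hc'
  have hc0 : 0 < c := pos_iff_ne_zero.2 (by simpa using hc)
  have hca' : c ≤ a := by exact_mod_cast hca
  have hf1 : 1 ≤ ⌊a / c⌋₊ := Nat.one_le_floor_iff _ |>.2 ((one_le_div hc0).2 hca')
  have hle : (⌊a / c⌋₊ : NNReal) * c ≤ a :=
    (le_div_iff₀ hc0).1 (Nat.floor_le zero_le)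
  have hlt : a < ((⌊a / c⌋₊ : NNReal) + 1) * c := (div_lt_iff₀ hc0).1 (Nat.lt_floor_add_one _)
  refine ⟨⌊a / c⌋₊ - 1, ((a - ⌊a / c⌋₊ * c : NNReal) : ENNReal), ?_, ?_⟩
  · rw [ENNReal.coe_lt_coe, tsub_lt_iff_left hle]
    linarith
  · rw [Nat.sub_add_cancel hf1]
    exact_mod_cast (add_tsub_cancel_of_le hle).symm

/-- The transport argument. The cells `C i` are disjoint and each contains a core `Q i` of measure
at least `c`. A cell at a non-cut vertex of the graph is cut into pieces of measure `c`; what is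
left over has measure less than `c`, so it can be chosen inside the core, and is handed to a
neighbouring cell. The core of that neighbour is untouched, hence the argument repeats until one
cell is left, whose measure is then a multiple of `c`. -/
theorem hasEquipartition_iUnion_of_connected [IsFiniteMeasure μ]
    (hμ : ∀ (A : Set X) (t : ENNReal), MeasurableSet A → t ≤ μ A →
      ∃ B ⊆ A, MeasurableSet B ∧ μ B = t)
    (hc : c ≠ 0) (n : ℕ) {ι : Type v} [Finite ι] (hn : Nat.card ι = n) {Γ : SimpleGraph ι}
    (hΓ : Γ.Connected) {C Q N : ι → Set X} (hC : ∀ i, MeasurableSet (C i))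
    (hdisj : Pairwise fun i j => Disjoint (C i) (C j)) (hQ : ∀ i, MeasurableSet (Q i))
    (hQC : ∀ i, Q i ⊆ C i) (hcQ : ∀ i, c ≤ μ (Q i)) (hCN : ∀ i, C i ⊆ N i)
    (hQN : ∀ i j, Γ.Adj i j → Q j ⊆ N i) {k : ℕ} (hk : μ (⋃ i, C i) = k * c) :
    HasEquipartition μ c (fun S => ∃ i, S ⊆ N i) (⋃ i, C i) := by
  classical
  induction n generalizing ι k with
  | zero =>
    have := hΓ.nonempty
    exact absurd hn Nat.card_pos.ne'
  | succ n ih =>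
    rcases subsingleton_or_nontrivial ι with hsub | hnt
    · obtain ⟨i⟩ := hΓ.nonempty
      have hU : ⋃ j, C j = C i := by
        refine Subset.antisymm (iUnion_subset fun j => ?_) (subset_iUnion C i)
        rw [Subsingleton.elim j i]
      rw [hU] at hk ⊢
      have hk0 : k ≠ 0 := by
        rintro rfl
        have : c ≤ 0 := by simpa [hk] using (hcQ i).trans (measure_mono (hQC i))
        exact hc (le_zero_iff.1 this)
      obtain ⟨m, rfl⟩ := Nat.exists_eq_succ_of_ne_zero hk0
      exact (hasEquipartition_of_measure_eq hμ m (hC i) hk).mono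
        fun S hS => ⟨i, hS.trans (hCN i)⟩
    · obtain ⟨v, hv⟩ := hΓ.exists_connected_induce_compl_singleton_of_finite_nontrivial
      obtain ⟨w, hw⟩ := hΓ.preconnected.exists_adj_of_nontrivial v
      obtain ⟨m, r, hrc, hCm⟩ := exists_nat_mul_add_lt hc
        ((hcQ v).trans (measure_mono (hQC v))) (measure_ne_top μ (C v))
      obtain ⟨L, hLQ, hL, hLr⟩ := hμ (Q v) r (hQ v) (hrc.le.trans (hcQ v))
      have hLC : L ⊆ C v := hLQ.trans (hQC v)
      have hdiff : μ (C v \ L) = (m + 1 : ℕ) * c := by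
        rw [measure_sdiff hLC hL.nullMeasurableSet (measure_ne_top μ L), hCm, hLr,
          ENNReal.add_sub_cancel_right (hLr ▸ measure_ne_top μ L)]
      have hv_part : HasEquipartition μ c (fun S => ∃ i, S ⊆ N i) (C v \ L) :=
        (hasEquipartition_of_measure_eq hμ m ((hC v).diff hL) hdiff).mono
          fun S hS => ⟨v, hS.trans (sdiff_subset.trans (hCN v))⟩
      have hne : ∀ i : ({v}ᶜ : Set ι), i.1 ≠ v := fun i => i.2
      let C' : ({v}ᶜ : Set ι) → Set X := fun i => if i.1 = w then C i ∪ L else C i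
      have hCC' : ∀ i, C i.1 ⊆ C' i := fun i => by
        simp only [C']; split_ifs <;> simp
      have hC'C : ∀ i, C' i ⊆ C i.1 ∪ L := fun i => by
        simp only [C']; split_ifs <;> simp
      have hdL : ∀ i : ({v}ᶜ : Set ι), Disjoint (C i.1) L := fun i =>
        (hdisj (hne i)).mono_right hLC
      have hU : ⋃ i, C i = (C v \ L) ∪ ⋃ i, C' i := by
        ext x
        simp only [mem_iUnion, mem_union]
        constructor
        · rintro ⟨i, hi⟩
          by_cases hiv : i = v
          · subst hiv
            by_cases hxL : x ∈ L
            · exact Or.inr ⟨⟨w, hw.ne'⟩, by simp [C', hxL]⟩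
            · exact Or.inl ⟨hi, hxL⟩
          · exact Or.inr ⟨⟨i, hiv⟩, hCC' ⟨i, hiv⟩ hi⟩
        · rintro (hx | ⟨i, hi⟩)
          · exact ⟨v, hx.1⟩
          · rcases hC'C i hi with h | h
            exacts [⟨i, h⟩, ⟨v, hLC h⟩]
      have hdU : Disjoint (C v \ L) (⋃ i, C' i) := by
        refine disjoint_iUnion_right.2 fun i => Disjoint.mono_right (hC'C i) ?_
        exact disjoint_union_right.2 ⟨(hdisj (hne i).symm).mono_left sdiff_subset,
          disjoint_sdiff_left⟩
      have hC' : ∀ i, MeasurableSet (C' i) := fun i => by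
        simp only [C']; split_ifs
        exacts [(hC _).union hL, hC _]
      rw [hU]
      refine hv_part.union ?_ hdU
      have hsum : ((m + 1 : ℕ) : ENNReal) * c + μ (⋃ i, C' i) = k * c := by
        rw [← hk, hU, measure_union hdU (MeasurableSet.iUnion hC'), hdiff]
      have hcv : c ≠ ⊤ := ne_top_of_le_ne_top (measure_ne_top μ (Q v)) (hcQ v)
      have hk' : μ (⋃ i, C' i) = (k - (m + 1) : ℕ) * c := by
        rw [ENNReal.natCast_sub, ENNReal.sub_mul fun _ _ => hcv, ← hsum]
        exact (ENNReal.add_sub_cancel_left (by finiteness)).symm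
      have hcard : Nat.card ({v}ᶜ : Set ι) = n := by
        have := Set.ncard_add_ncard_compl ({v} : Set ι)
        rw [Set.ncard_singleton, hn] at this
        rw [Nat.card_coe_set_eq]
        omega
      have hpart := ih (ι := ({v}ᶜ : Set ι)) hcard hv (C := C') (Q := fun i => Q i)
        (N := fun i => N i) hC' ?_ (fun i => hQ i) (fun i => (hQC i).trans (hCC' i))
        (fun i => hcQ i) ?_ (fun i j hij => hQN i j hij) hk'
      · exact hpart.mono fun S ⟨i, hi⟩ => ⟨i, hi⟩
      · intro i j hij
        have hij' : i.1 ≠ j.1 := fun h => hij (Subtype.ext h)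
        have := hdisj hij'
        simp only [C']
        split_ifs with h1 h2 h2
        · exact absurd (h1.trans h2.symm) hij'
        · exact disjoint_union_left.2 ⟨this, (hdL j).symm⟩
        · exact disjoint_union_right.2 ⟨this, hdL i⟩
        · exact this
      · intro i
        simp only [C']
        split_ifs with h1
        · refine union_subset (hCN i) (hLQ.trans (hQN i v ?_))
          rw [h1]; exact hw.symm
        · exact hCN i

/-- A finite measurable cover of a measurable set can be shrunk to a measurable partition with the
same index type. -/
theorem exists_measurable_disjoint_subordinate {ι : Type v} [Finite ι] {S : ι → Set X}
    (hS : ∀ i, MeasurableSet (S i)) {T : Set X} (hT : MeasurableSet T) (hTS : T ⊆ ⋃ i, S i) :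
    ∃ R : ι → Set X, (∀ i, MeasurableSet (R i)) ∧ (∀ i, R i ⊆ S i) ∧
      (Pairwise fun i j => Disjoint (R i) (R j)) ∧ ⋃ i, R i = T := by
  let e := Finite.equivFin ι
  refine ⟨fun i => (T ∩ S i) \ ⋃ j : {j // e j < e i}, S j, fun i => ?_,
    fun i => sdiff_subset.trans inter_subset_right, fun i j hij => ?_, ?_⟩
  · exact (hT.inter (hS i)).diff (MeasurableSet.iUnion fun j => hS j)
  · refine disjoint_left.2 ?_
    rintro x ⟨hxi, hxi'⟩ ⟨hxj, hxj'⟩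
    rcases lt_or_gt_of_ne (e.injective.ne hij) with h | h
    · exact hxj' (mem_iUnion.2 ⟨⟨i, h⟩, hxi.2⟩)
    · exact hxi' (mem_iUnion.2 ⟨⟨j, h⟩, hxj.2⟩)
  · refine Subset.antisymm (iUnion_subset fun i => sdiff_subset.trans inter_subset_left) ?_
    intro x hx
    obtain ⟨i, hi, hmin⟩ := (toFinite {i | x ∈ S i}).exists_minimalFor e _
      (by simpa [Set.Nonempty] using hTS hx)
    refine mem_iUnion.2 ⟨i, ⟨hx, hi⟩, fun hxU => ?_⟩
    obtain ⟨⟨j, hj⟩, hxj⟩ := mem_iUnion.1 hxU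
    exact hj.not_ge (hmin hxj hj.le)

end Equipartition

/-! ### Cells made of translates in a compact group -/

section Group

variable {G : Type u} [Group G]

/-- The graph on a set `F` of group elements in which `f` and `g` are adjacent if they are distinct
and `g ∈ f W`; the set `W` is meant to be symmetric. -/
def translateGraph (W : Set G) (hW : W⁻¹ = W) (F : Set G) : SimpleGraph F where
  Adj f g := f ≠ g ∧ (f : G)⁻¹ * g ∈ W
  symm := ⟨fun f g h => ⟨h.1.symm, by
    rw [← hW, Set.mem_inv]
    simpa using h.2⟩⟩
  loopless := ⟨fun _ h => h.1 rfl⟩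

theorem pow_inv_of_inv_eq {V : Set G} (hV : V⁻¹ = V) (n : ℕ) : (V ^ n)⁻¹ = V ^ n := by
  rw [← inv_pow, hV]

/-- If the translates `f V ^ 3`, `f ∈ F`, cover the subgroup generated by `V`, then `F` is connected
by steps in `V ^ 7`: the union of the translates belonging to one component is invariant under right
multiplication by `V`, hence is the whole subgroup. -/
theorem translateGraph_connected {V : Set G} (hV : V⁻¹ = V) (hV1 : 1 ∈ V) {F : Set G}
    (hF : F ⊆ Subgroup.closure V)
    (hcov : ∀ x ∈ Subgroup.closure V, ∃ f ∈ F, f⁻¹ * x ∈ V ^ 3) :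
    (translateGraph (V ^ 7) (pow_inv_of_inv_eq hV 7) F).Connected := by
  set Γ := translateGraph (V ^ 7) (pow_inv_of_inv_eq hV 7) F
  have hstep : ∀ f g : F, (f : G)⁻¹ * g ∈ V ^ 7 → Γ.Reachable f g := fun f g h => by
    by_cases hfg : f = g
    · rw [hfg]
    · exact SimpleGraph.Adj.reachable ⟨hfg, h⟩
  have hreach : ∀ f : F, ∀ x ∈ Subgroup.closure V,
      ∃ g : F, Γ.Reachable f g ∧ (g : G)⁻¹ * (f * x) ∈ V ^ 3 := by
    intro f x hx
    have key : ∀ x ∈ Subgroup.closure V, ∀ y ∈ V,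
        (∃ g : F, Γ.Reachable f g ∧ (g : G)⁻¹ * (f * x) ∈ V ^ 3) →
        ∃ g : F, Γ.Reachable f g ∧ (g : G)⁻¹ * (f * (x * y)) ∈ V ^ 3 := by
      rintro x hx y hy ⟨g, hfg, hg⟩
      obtain ⟨g', hg'F, hg'⟩ := hcov (f * (x * y)) (mul_mem (hF f.2)
        (mul_mem hx (Subgroup.subset_closure hy)))
      refine ⟨⟨g', hg'F⟩, hfg.trans (hstep _ _ ?_), hg'⟩
      have h1 : (f * (x * y))⁻¹ * g' ∈ V ^ 3 := by
        rw [← pow_inv_of_inv_eq hV 3, Set.mem_inv]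
        simpa using hg'
      have h2 : ((g : G)⁻¹ * (f * x)) * y * ((f * (x * y))⁻¹ * g') ∈ V ^ 3 * V * V ^ 3 :=
        mul_mem_mul (mul_mem_mul hg hy) h1
      rw [← pow_succ, ← pow_add] at h2
      convert h2 using 1
      group
    induction hx using Subgroup.closure_induction_right with
    | one => exact ⟨f, SimpleGraph.Reachable.refl f, by simpa using one_mem_pow hV1⟩
    | mul_right x hx y hy ih => exact key x hx y hy ih
    | mul_inv_cancel x hx y hy ih => exact key x hx y⁻¹ (by rw [← hV]; simpa using hy) ih
  have hne : Nonempty F := by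
    obtain ⟨f, hf, -⟩ := hcov 1 (one_mem _)
    exact ⟨⟨f, hf⟩⟩
  refine ⟨fun f f' => ?_⟩
  obtain ⟨g, hfg, hg⟩ := hreach f ((f : G)⁻¹ * f') (mul_mem (inv_mem (hF f.2)) (hF f'.2))
  refine hfg.trans (hstep _ _ ?_)
  rw [mul_inv_cancel_left] at hg
  exact pow_subset_pow_right hV1 (by norm_num) hg

/-- A maximal family of disjoint translates of `V`, chosen among a finite cover by translates; the
corresponding translates of `V * V⁻¹ * V = V ^ 3` then cover. -/
theorem exists_finite_disjoint_translates [TopologicalSpace G] [IsTopologicalGroup G]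
    {K V : Set G} (hK : IsCompact K) (hV1 : V ∈ 𝓝 (1 : G)) (hV : V⁻¹ = V) :
    ∃ F : Set G, F.Finite ∧ F ⊆ K ∧ F.PairwiseDisjoint (fun f => f • V) ∧
      ∀ x ∈ K, ∃ f ∈ F, f⁻¹ * x ∈ V ^ 3 := by
  obtain ⟨F₀, hF₀K, hcov⟩ := hK.elim_nhds_subcover (fun g => g • V)
    fun g _ => by simpa using smul_mem_nhds_smul g hV1
  have hfin : {F : Set G | F ⊆ F₀ ∧ F.PairwiseDisjoint (fun f => f • V)}.Finite :=
    F₀.finite_toSet.finite_subsets.subset fun F hF => hF.1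
  obtain ⟨F, hF⟩ := hfin.exists_maximal ⟨∅, by simp⟩
  refine ⟨F, F₀.finite_toSet.subset hF.prop.1, fun f hf => hF₀K f (hF.prop.1 hf), hF.prop.2, ?_⟩
  intro x hx
  obtain ⟨g, hg, hxg⟩ := mem_iUnion₂.1 (hcov hx)
  have hmeet : ∃ f ∈ F, ¬ Disjoint (g • V) (f • V) := by
    by_cases hgF : g ∈ F
    · refine ⟨g, hgF, ?_⟩
      rw [disjoint_self, Set.bot_eq_empty, Set.smul_set_eq_empty]
      exact Set.Nonempty.ne_empty ⟨1, mem_of_mem_nhds hV1⟩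
    · by_contra! hno
      exact hgF (hF.le_of_ge ⟨insert_subset hg hF.prop.1,
        hF.prop.2.insert fun f hf _ => hno f hf⟩ (subset_insert g F) (mem_insert g F))
  obtain ⟨f, hf, hfg⟩ := hmeet
  obtain ⟨y, hyg, hyf⟩ := not_disjoint_iff.1 hfg
  rw [mem_smul_set_iff_inv_smul_mem, smul_eq_mul] at hxg hyg hyf
  refine ⟨f, hf, ?_⟩
  have h1 : (g⁻¹ * y)⁻¹ ∈ V := by rw [← hV]; simpa using hyg
  have h2 : (f⁻¹ * y) * (g⁻¹ * y)⁻¹ * (g⁻¹ * x) ∈ V * V * V := mul_mem_mul (mul_mem_mul hyf h1) hxg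
  rw [← pow_two, ← pow_succ] at h2
  convert h2 using 1
  group

theorem exists_closed_symm_nhds_one_pow_eight_subset [TopologicalSpace G] [IsTopologicalGroup G]
    {U : Set G} (hU : U ∈ 𝓝 (1 : G)) :
    ∃ V ∈ 𝓝 (1 : G), IsClosed V ∧ V⁻¹ = V ∧ V ^ 8 ⊆ U := by
  obtain ⟨V₁, h1, -, -, hV₁⟩ := exists_closed_nhds_one_inv_eq_mul_subset hU
  obtain ⟨V₂, h2, -, -, hV₂⟩ := exists_closed_nhds_one_inv_eq_mul_subset h1
  obtain ⟨V, h3, hc, hs, hV⟩ := exists_closed_nhds_one_inv_eq_mul_subset h2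
  refine ⟨V, h3, hc, hs, ?_⟩
  rw [← pow_two] at hV hV₂ hV₁
  calc V ^ 8 = ((V ^ 2) ^ 2) ^ 2 := by rw [← pow_mul, ← pow_mul]
    _ ⊆ U := (pow_subset_pow_left ((pow_subset_pow_left hV).trans hV₂)).trans hV₁

variable [TopologicalSpace G] [IsTopologicalGroup G] [CompactSpace G] [T2Space G]
  [MeasurableSpace G] [BorelSpace G]

/-- Haar measure on a non-discrete compact group has no atoms: the identity has neighbourhoods of
arbitrarily small measure, and finitely many translates of one of them cover the group. -/
theorem exists_measurable_subset_haar_eq (hG : ¬ DiscreteTopology G) (ν : Measure G)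
    [ν.IsHaarMeasure] [ν.Regular] (A : Set G) (t : ENNReal) (hA : MeasurableSet A)
    (ht : t ≤ ν A) : ∃ B ⊆ A, MeasurableSet B ∧ ν B = t := by
  refine exists_measurable_subset_measure_eq (fun ε hε => ?_) hA ht
  have : (𝓝[≠] (1 : G)).NeBot := by
    refine ⟨fun h => hG ?_⟩
    rw [discreteTopology_iff_isOpen_singleton_one]
    exact isOpen_singleton_iff_punctured_nhds _ |>.2 h
  obtain ⟨W, h1W, hW, hWε⟩ := Set.exists_isOpen_lt_of_lt (μ := ν) ({1} : Set G) ε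
    (by rw [measure_singleton]; exact pos_iff_ne_zero.2 hε)
  obtain ⟨F, -, hcov⟩ := isCompact_univ.elim_nhds_subcover (fun g : G => g • W)
    fun g _ => by simpa using smul_mem_nhds_smul g (hW.mem_nhds (h1W rfl))
  refine ⟨(fun g : G => g • W) '' F, F.finite_toSet.image _, ?_, ?_, ?_⟩
  · rintro _ ⟨g, -, rfl⟩
    exact (hW.smul g).measurableSet
  · rintro _ ⟨g, -, rfl⟩
    simpa using hWε.le
  · rw [sUnion_image]
    exact univ_subset_iff.1 hcov

/-- The open subgroup generated by `V` has an equipartition into sets contained in translates of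
`V ^ 8`. The cells are subsets of the translates `f V ^ 3` with core `f V`, for a maximal family of
disjoint translates `f V`, and mass moves between cells whose centres differ by an element of
`V ^ 7`. -/
theorem hasEquipartition_closure (hG : ¬ DiscreteTopology G) (ν : Measure G)
    [ν.IsHaarMeasure] [ν.Regular] {V : Set G} (hV1 : V ∈ 𝓝 (1 : G)) (hVc : IsClosed V)
    (hV : V⁻¹ = V) :
    ∃ c : ENNReal, c ≠ 0 ∧
      HasEquipartition ν c (fun S => ∃ g : G, S ⊆ g • V ^ 8) (Subgroup.closure V : Set G) := by
  set H := Subgroup.closure V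
  have hVH : V ⊆ H := Subgroup.subset_closure
  have hHo : IsOpen (H : Set G) := H.isOpen_of_mem_nhds (Filter.mem_of_superset hV1 hVH)
  have h1V : (1 : G) ∈ V := mem_of_mem_nhds hV1
  obtain ⟨F, hFfin, hFH, hFdisj, hcov⟩ :=
    exists_finite_disjoint_translates (H.isClosed_of_isOpen hHo).isCompact hV1 hV
  have := hFfin.to_subtype
  have hνV : ν V ≠ 0 := (Measure.measure_pos_of_mem_nhds ν hV1).ne'
  obtain ⟨n, hn⟩ := ENNReal.exists_nat_mul_gt hνV (measure_ne_top ν (H : Set G))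
  have hn0 : (n : ENNReal) ≠ 0 := by
    rintro h
    simp [h] at hn
  have hνH : ν (H : Set G) ≠ 0 := (hνV.bot_lt.trans_le (measure_mono hVH)).ne'
  have hmeas3 : ∀ f : F, MeasurableSet ((f : G) • V ^ 3) := fun f => by
    have : IsCompact (V ^ 3) := by
      rw [pow_succ, pow_two]
      exact (hVc.isCompact.mul hVc.isCompact).mul hVc.isCompact
    exact (this.smul (f : G)).measurableSet
  have hmeas1 : ∀ f : F, MeasurableSet ((f : G) • V) := fun f =>
    (hVc.smul (f : G)).measurableSet
  have hsub : ∀ {m : ℕ} (f : F), m ≤ 8 → (f : G) • V ^ m ⊆ (f : G) • V ^ 8 := fun f hm =>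
    smul_set_mono (pow_subset_pow_right h1V hm)
  obtain ⟨R, hR, hRsub, hRdisj, hRU⟩ := exists_measurable_disjoint_subordinate hmeas3
    (T := (H : Set G) \ ⋃ f : F, (f : G) • V)
    (hHo.measurableSet.diff (MeasurableSet.iUnion hmeas1)) <| by
      rintro x ⟨hx, -⟩
      obtain ⟨f, hf, hfx⟩ := hcov x hx
      exact mem_iUnion.2 ⟨⟨f, hf⟩, mem_smul_set_iff_inv_smul_mem.2 hfx⟩
  have hQR : ∀ f g : F, Disjoint ((f : G) • V) (R g) := fun f g =>
    disjoint_left.2 fun x hx hxR =>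
      (hRU ▸ mem_iUnion_of_mem g hxR : x ∈ (H : Set G) \ ⋃ f : F, (f : G) • V).2
        (mem_iUnion_of_mem f hx)
  have hU : ⋃ f : F, ((f : G) • V ∪ R f) = H := by
    rw [iUnion_union_distrib, hRU, union_sdiff_cancel]
    refine iUnion_subset fun f => ?_
    rintro _ ⟨v, hv, rfl⟩
    exact mul_mem (hFH f.2) (hVH hv)
  have hc0 : ν (H : Set G) / n ≠ 0 := ENNReal.div_ne_zero.2 ⟨hνH, by finiteness⟩
  refine ⟨ν (H : Set G) / n, hc0, ?_⟩
  have hpart := hasEquipartition_iUnion_of_connected (μ := ν)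
    (exists_measurable_subset_haar_eq hG ν) hc0 _ rfl (translateGraph_connected hV h1V hFH hcov)
    (C := fun f => (f : G) • V ∪ R f) (Q := fun f => (f : G) • V)
    (N := fun f => (f : G) • V ^ 8) (k := n) (fun f => (hmeas1 f).union (hR f)) ?_ hmeas1
    (fun f => subset_union_left) ?_ ?_ ?_ ?_
  · rw [hU] at hpart
    exact hpart.mono fun S ⟨f, hf⟩ => ⟨f, hf⟩
  · intro f g hfg
    refine disjoint_union_left.2 ⟨disjoint_union_right.2 ⟨?_, hQR f g⟩,
      disjoint_union_right.2 ⟨(hQR g f).symm, hRdisj hfg⟩⟩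
    exact hFdisj f.2 g.2 fun h => hfg (Subtype.ext h)
  · intro f
    rw [measure_smul]
    exact ENNReal.div_le_of_le_mul' hn.le
  · intro f
    refine union_subset ?_ ((hRsub f).trans (hsub f (by norm_num)))
    simpa using hsub (m := 1) f (by norm_num)
  · rintro f g ⟨-, hfg⟩ _ ⟨v, hv, rfl⟩
    rw [mem_smul_set_iff_inv_smul_mem, pow_succ]
    simpa [mul_assoc] using mul_mem_mul hfg hv
  · rw [hU, ENNReal.mul_div_cancel hn0 (by finiteness)]

end Group

theorem theorem2 {G : Type*} [Group G] [TopologicalSpace G] [IsTopologicalGroup G]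
    [CompactSpace G] [T2Space G] (hG : ¬ DiscreteTopology G)
    [MeasurableSpace G] [BorelSpace G]
    (ν : Measure G) [ν.IsHaarMeasure] [ν.Regular] [IsProbabilityMeasure ν]
    (U : Set G) (hU : U ∈ 𝓝 (1 : G)) :
    ∃ P : Set (Set G), P.Finite ∧ Setoid.IsPartition P ∧ (∀ A ∈ P, MeasurableSet A) ∧
      IsFine U P ∧ IsEquisize ν P := by
  obtain ⟨V, hV1, hVc, hV, hVU⟩ := exists_closed_symm_nhds_one_pow_eight_subset hU
  obtain ⟨c, hc, P, hPfin, hPdisj, hPU, hP⟩ := hasEquipartition_closure hG ν hV1 hVc hV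
  set H := Subgroup.closure V
  have hHo : IsOpen (H : Set G) :=
    H.isOpen_of_mem_nhds (Filter.mem_of_superset hV1 Subgroup.subset_closure)
  have := H.quotient_finite_of_isOpen hHo
  -- The pieces of `H` are moved to each left coset by a chosen representative.
  have hall : ∀ A ∈ image2 (fun (q : G ⧸ H) (A : Set G) => q.out • A) univ P,
      MeasurableSet A ∧ ν A = c ∧ ∃ g : G, A ⊆ g • U := by
    rintro _ ⟨q, -, A, hA, rfl⟩
    obtain ⟨hm, hνA, g, hg⟩ := hP A hA
    refine ⟨hm.const_smul _, by simpa using hνA, q.out * g, ?_⟩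
    rw [mul_smul]
    exact smul_set_mono (hg.trans (smul_set_mono hVU))
  refine ⟨image2 (fun (q : G ⧸ H) (A : Set G) => q.out • A) univ P, finite_univ.image2 _ hPfin,
    ⟨fun h => ?_, fun x => ?_⟩, fun A hA => (hall A hA).1, fun A hA => (hall A hA).2.2,
    fun A hA B hB => (hall A hA).2.1.trans (hall B hB).2.1.symm⟩
  · exact hc (by simpa using (hall ∅ h).2.1.symm)
  · have hx : (x : G ⧸ H).out⁻¹ * x ∈ ⋃₀ P := by
      rw [hPU]
      exact QuotientGroup.eq.1 (QuotientGroup.out_eq' _)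
    obtain ⟨A, hA, hxA⟩ := hx
    refine ⟨(x : G ⧸ H).out • A, ⟨⟨_, mem_univ _, A, hA, rfl⟩,
      mem_smul_set_iff_inv_smul_mem.2 hxA⟩, ?_⟩
    rintro _ ⟨⟨q, -, B, hB, rfl⟩, hxB⟩
    rw [mem_smul_set_iff_inv_smul_mem, smul_eq_mul] at hxB
    have hq : q = (x : G ⧸ H) := by
      rw [← QuotientGroup.out_eq' q]
      exact QuotientGroup.eq.2 (hPU ▸ mem_sUnion_of_mem hxB hB : _ ∈ (H : Set G))
    subst hq
    by_contra hne
    have hAB : A ≠ B := fun h => hne (by rw [h])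
    exact disjoint_left.1 (hPdisj hA hB hAB) hxA hxB
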